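/- For a group $G$ and $k,n\in\mathbb{N}$ let $\gamma_G(k,n)=\max\{|S^n| : S\subseteq G,\ |S|=k\}$, where $S^n=\{s_1\cdots s_n : s_1,\dots,s_n\in S\}$. Let $D_\infty=\mathbb{Z}\rtimes\mathbb{Z}/2$ be the infinite dihedral group, and call $G$ finite-by-$H$ if there is a surjective homomorphism $G\to H$ with finite kernel. Let $G$ be an infinite virtually cyclic group, that is, an infinite group with a cyclic subgroup of finite index. Then: (1) For every fixed $k\geq 1$, $\gamma_G(k,n)\asymp n^{k-1}$ as $n\to\infty$; that is, there are constants $c,C>0$, depending only on $G$ and $k$, such that $c\,n^{k-1}\leq\gamma_G(k,n)\leq C\,n^{k-1}$ for all sufficiently large $n$. (2) $G$ is finite-by-$\mathbb{Z}$ or finite-by-$D_\infty$, and $$\limsup_{n\to\infty}\gamma_G(n,n)^{1/n}=\begin{cases}4 & \text{if } G \text{ is finite-by-}\mathbb{Z},\\ 3+2\sqrt{2} & \text{if } G \text{ is finite-by-}D_\infty.\end{cases}$$ -/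

import Mathlib

open Filter Asymptotics
open scoped Pointwise

/-- `maxGrowth G k n` is the maximum of `|S ^ n|` over all subsets `S` of `G` with exactly `k`
elements, where `S ^ n = {s₁ ⋯ sₙ | s₁, …, sₙ ∈ S}` is the pointwise power of the set `S`. -/
noncomputable def maxGrowth (G : Type*) [Group G] (k n : ℕ) : ℕ :=
  sSup {m : ℕ | ∃ S : Finset G, S.card = k ∧ m = ((S : Set G) ^ n).ncard}

/-- The supremum in `maxGrowth` is a maximum over a nonempty bounded set of natural numbers. -/
theorem isGreatest_maxGrowth (G : Type*) [Group G] [Infinite G] (k n : ℕ) :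
    IsGreatest {m : ℕ | ∃ S : Finset G, S.card = k ∧ m = ((S : Set G) ^ n).ncard}
      (maxGrowth G k n) := by
  classical
  have hne : {m : ℕ | ∃ S : Finset G, S.card = k ∧ m = ((S : Set G) ^ n).ncard}.Nonempty := by
    obtain ⟨S, hS⟩ := Infinite.exists_subset_card_eq G k
    exact ⟨_, S, hS, rfl⟩
  have hbdd : BddAbove {m : ℕ | ∃ S : Finset G, S.card = k ∧ m = ((S : Set G) ^ n).ncard} := by
    refine ⟨k ^ n, ?_⟩
    rintro m ⟨S, rfl, rfl⟩
    rw [← Finset.coe_pow, Set.ncard_coe_finset]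
    exact Finset.card_pow_le
  exact ⟨Nat.sSup_mem hne hbdd, fun m hm => le_csSup hbdd hm⟩

/-- `G` is virtually cyclic: it has a cyclic subgroup of finite index. If `G` is infinite, such
a subgroup is infinite cyclic. -/
def IsVirtuallyCyclic (G : Type*) [Group G] : Prop :=
  ∃ C : Subgroup G, IsCyclic C ∧ C.FiniteIndex

/-- `G` is finite-by-`H`: there is an exact sequence `1 → N → G → H → 1` with `N` finite. -/
def IsFiniteBy (G H : Type*) [Group G] [Group H] : Prop :=
  ∃ f : G →* H, Function.Surjective f ∧ Finite f.ker

/-!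
# Product set growth of infinite virtually cyclic groups

An infinite virtually cyclic group `G` maps with finite kernel onto `H`, where `H` is `ℤ` or the
infinite dihedral group (`isFiniteBy_int_or_dihedral`). Such a map changes `maxGrowth` by at most
the factor `|ker|` (`maxGrowth_le_of_surjective`, `maxGrowth_le_card_ker_mul`), so only these two
groups matter.

In `ℤ` a product of `n` factors out of `k` elements depends only on the multiset of factors, and
for generic elements there are no coincidences, so `maxGrowth ℤ k n` is the multiset coefficient
`k.multichoose n` (`maxGrowth_int_le_multichoose`, `multichoose_le_maxGrowth_int`). It grows like
`n ^ (k - 1)` for fixed `k`, and like `4 ^ n` up to a polynomial factor for `k = n`.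

In the infinite dihedral group every reflection negates what has been accumulated so far, so a
product of `n` factors is encoded by a vector of `k` signed multiplicities with `ℓ¹` norm at
most `n` (`exists_coeff_of_mem_range_dihMk_pow`). One linear form, either the sum over the
reflections or, in their absence, the sum over everything, takes at most two values on these
vectors, whence the exponent `k - 1` (`maxGrowth_dihedral_le`). For `k = n`, generic translations
and one reflection realize essentially all vectors (`ncard_l1Ball_le_maxGrowth_dihedral`), and the
number of lattice points in the `ℓ¹` ball of radius `n` in dimension `n` is the central Delannoy
number `∑ j, (n.choose j) ^ 2 * 2 ^ j` (`ncard_l1Ball`). By the Cauchy–Schwarz inequality this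
equals `(∑ j, n.choose j * √2 ^ j) ^ 2 = (3 + 2 * √2) ^ n` up to a factor at most `n + 1`.
-/

/-! ### The infinite dihedral group with integer coordinates -/

/-- The rotation of the infinite dihedral group with integer parameter `n`, that is, the
translation by `n`. -/
def dihRot (n : ℤ) : DihedralGroup 0 := DihedralGroup.r (Int.cast n)

/-- The reflection of the infinite dihedral group with integer parameter `n`. -/
def dihRefl (n : ℤ) : DihedralGroup 0 := DihedralGroup.sr (Int.cast n)

theorem dihRot_mul_dihRot (m n : ℤ) : dihRot m * dihRot n = dihRot (m + n) := by
  simp [dihRot]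

theorem dihRot_mul_dihRefl (m n : ℤ) : dihRot m * dihRefl n = dihRefl (n - m) := by
  simp [dihRot, dihRefl]

theorem dihRefl_mul_dihRot (m n : ℤ) : dihRefl m * dihRot n = dihRefl (m + n) := by
  simp [dihRot, dihRefl]

theorem dihRefl_mul_dihRefl (m n : ℤ) : dihRefl m * dihRefl n = dihRot (n - m) := by
  simp [dihRot, dihRefl]

theorem dihRot_zero : dihRot 0 = 1 := by
  simp [dihRot]

theorem dihRot_injective : Function.Injective dihRot := fun m n h => by
  simpa [dihRot] using h

theorem dihRefl_injective : Function.Injective dihRefl := fun m n h => by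
  simpa [dihRefl] using h

theorem dihRot_ne_dihRefl (m n : ℤ) : dihRot m ≠ dihRefl n := by
  simp [dihRot, dihRefl]

theorem exists_dihRot_or_dihRefl (x : DihedralGroup 0) :
    (∃ n, x = dihRot n) ∨ ∃ n, x = dihRefl n := by
  obtain i | i := x <;> obtain ⟨n, rfl⟩ := ZMod.intCast_surjective i
  · exact .inl ⟨n, rfl⟩
  · exact .inr ⟨n, rfl⟩

/-- The inclusion of the translations into the infinite dihedral group. -/
def dihRotHom : Multiplicative ℤ →* DihedralGroup 0 where
  toFun n := dihRot n.toAdd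
  map_one' := dihRot_zero
  map_mul' _ _ := (dihRot_mul_dihRot _ _).symm

/-! ### Infinite virtually cyclic groups -/

theorem Subgroup.mulEquiv_multiplicative_int_of_infinite {G : Type*} [Group G] (C : Subgroup G)
    [IsCyclic C] [Infinite C] : Nonempty (C ≃* Multiplicative ℤ) :=
  ⟨mulEquivOfCyclicCardEq (by simp [Nat.card_eq_zero_of_infinite])⟩

/-- A group with a central infinite cyclic subgroup `C` of finite index is finite-by-`ℤ`. The
transfer to `C` is `g ↦ g ^ C.index`; it is injective on `C`, so its kernel meets `C` trivially
and is finite, and its image is an infinite subgroup of `ℤ`. -/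
theorem isFiniteBy_int_of_le_center {K : Type*} [Group K] (C : Subgroup K) [IsCyclic C]
    [Infinite C] [C.FiniteIndex] (hC : C ≤ Subgroup.center K) :
    IsFiniteBy K (Multiplicative ℤ) := by
  obtain ⟨e⟩ := C.mulEquiv_multiplicative_int_of_infinite
  have key (g : K) (k : ℕ) (g₀ : K) (h : g₀⁻¹ * g ^ k * g₀ ∈ C) :
      g₀⁻¹ * g ^ k * g₀ = g ^ k := by
    have := (Subgroup.mem_center_iff.1 (hC h)) g₀
    exact mul_right_cancel (b := g₀) (by rw [← this]; group)
  let φ : K →* Multiplicative ℤ := MonoidHom.transfer (e : C →* Multiplicative ℤ)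
  have hφ (g : K) : φ g = e ⟨g ^ C.index, MonoidHom.transfer_eq_pow_aux g (key g)⟩ :=
    MonoidHom.transfer_eq_pow _ g (key g)
  have hφC (g : C) : φ g = e g ^ C.index := by
    rw [hφ, ← map_pow]; rfl
  have hindex : C.index ≠ 0 := Subgroup.FiniteIndex.index_ne_zero
  -- The kernel embeds into the finite quotient `K ⧸ C`, because `φ` is injective on `C`.
  have hker : Finite φ.ker := by
    refine Finite.of_injective (fun x : φ.ker => (QuotientGroup.mk (x : K) : K ⧸ C)) ?_
    rintro ⟨x, hx⟩ ⟨y, hy⟩ hxy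
    have hmem : x⁻¹ * y ∈ C := QuotientGroup.eq.1 hxy
    have h1 : φ (x⁻¹ * y) = 1 := by
      rw [map_mul, map_inv, MonoidHom.mem_ker.1 hx, MonoidHom.mem_ker.1 hy]; simp
    have h2 := hφC ⟨_, hmem⟩
    have h5 : e ⟨_, hmem⟩ = 1 := pow_left_injective hindex (by simpa [h1] using h2.symm)
    have h3 : (⟨x⁻¹ * y, hmem⟩ : C) = 1 := by simpa using h5
    have h4 : x⁻¹ * y = 1 := congrArg Subtype.val h3
    exact Subtype.ext (inv_mul_eq_one.1 h4)
  have hinf : Infinite φ.range := by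
    refine Infinite.of_injective (fun x : C => (⟨φ x, x, rfl⟩ : φ.range)) ?_
    intro x y hxy
    have h : φ x = φ y := congrArg Subtype.val hxy
    rw [hφC, hφC] at h
    exact e.injective (pow_left_injective hindex h)
  obtain ⟨e'⟩ := φ.range.mulEquiv_multiplicative_int_of_infinite
  refine ⟨(e' : φ.range →* Multiplicative ℤ).comp φ.rangeRestrict,
    e'.surjective.comp φ.rangeRestrict_surjective, ?_⟩
  have : ((e' : φ.range →* Multiplicative ℤ).comp φ.rangeRestrict).ker = φ.ker := by
    ext x; simp [MonoidHom.mem_ker]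
  rwa [this]

/-- A map from an index-two subgroup `K` onto `ℤ` that is inverted by conjugation with some
`s ∉ K` extends to a map onto the infinite dihedral group, sending `s * a` with `a ∈ K` to the
reflection with parameter `f a`. The kernel does not grow. -/
theorem isFiniteBy_dihedral_of_inverting {G : Type*} [Group G] (K : Subgroup G)
    (f : K →* Multiplicative ℤ) (hf : Function.Surjective f) (hker : Finite f.ker) (s : G)
    (hs : s ∉ K) (hK : ∀ x ∉ K, s⁻¹ * x ∈ K)
    (hconj : ∀ x : K, ∃ h : s⁻¹ * x * s ∈ K, f ⟨s⁻¹ * x * s, h⟩ = (f x)⁻¹) :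
    IsFiniteBy G (DihedralGroup 0) := by
  classical
  have hmul (x : G) : (x ∈ K ↔ s * x ∉ K) := by
    constructor
    · intro hx h
      exact hs ((K.mul_mem_cancel_right hx).1 h)
    · intro hx
      simpa using hK _ hx
  have hss : s * s ∈ K := by
    by_contra h
    exact hs ((hmul s).2 h)
  -- `s` commutes with `s * s`, so `f` inverts and fixes its value there.
  have hfss : f ⟨s * s, hss⟩ = 1 := by
    obtain ⟨h, h1⟩ := hconj ⟨s * s, hss⟩
    have h2 : (⟨s⁻¹ * (s * s) * s, h⟩ : K) = ⟨s * s, hss⟩ := Subtype.ext (by group)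
    simp only at h1
    rw [h2] at h1
    have h3 : Multiplicative.toAdd (f ⟨s * s, hss⟩) = -Multiplicative.toAdd (f ⟨s * s, hss⟩) :=
      congrArg Multiplicative.toAdd h1
    have h4 : Multiplicative.toAdd (f ⟨s * s, hss⟩) = 0 := by omega
    exact h4
  let F : G → DihedralGroup 0 := fun x =>
    if h : x ∈ K then dihRot (f ⟨x, h⟩).toAdd
    else dihRefl (f ⟨s⁻¹ * x, hK x h⟩).toAdd
  have F1 (x : K) : F x = dihRot (f x).toAdd := by
    simp [F]
  have F2 (x : K) : F (s * x) = dihRefl (f x).toAdd := by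
    simp [F, (hmul x).1 x.2]
  have hcases (x : G) : (∃ a : K, x = a) ∨ ∃ a : K, x = s * a := by
    by_cases h : x ∈ K
    · exact .inl ⟨⟨x, h⟩, rfl⟩
    · exact .inr ⟨⟨_, hK x h⟩, by simp⟩
  have hFmul (x y : G) : F (x * y) = F x * F y := by
    obtain ⟨a, rfl⟩ | ⟨a, rfl⟩ := hcases x <;> obtain ⟨b, rfl⟩ | ⟨b, rfl⟩ := hcases y
    · rw [← Subgroup.coe_mul, F1, F1, F1, dihRot_mul_dihRot, map_mul]
      simp
    · obtain ⟨h, h1⟩ := hconj a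
      have : (a : G) * (s * b) = s * ((⟨_, h⟩ * b : K) : G) := by
        simp [mul_assoc]
      rw [this, F1, F2, F2, dihRot_mul_dihRefl, map_mul, h1]
      simp [sub_eq_neg_add]
    · rw [mul_assoc, ← Subgroup.coe_mul, F1, F2, F2, dihRefl_mul_dihRot, map_mul]
      simp
    · obtain ⟨h, h1⟩ := hconj a
      have : s * (a : G) * (s * b) = ((⟨_, hss⟩ * ⟨_, h⟩ * b : K) : G) := by
        simp [mul_assoc]
      rw [this, F1, F2, F2, dihRefl_mul_dihRefl, map_mul f, map_mul f, h1, hfss]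
      simp [sub_eq_neg_add]
  refine ⟨MonoidHom.mk' F hFmul, ?_, ?_⟩
  · intro i
    obtain ⟨j, rfl⟩ | ⟨j, rfl⟩ := exists_dihRot_or_dihRefl i
    · obtain ⟨x, hx⟩ := hf (Multiplicative.ofAdd j)
      exact ⟨x, by simp [F1, hx]⟩
    · obtain ⟨x, hx⟩ := hf (Multiplicative.ofAdd j)
      exact ⟨s * x, by simp [F2, hx]⟩
  · refine Finite.of_surjective
      (fun x : f.ker => (⟨(x : K), ?_⟩ : (MonoidHom.mk' F hFmul).ker)) ?_
    · rw [MonoidHom.mem_ker, MonoidHom.mk'_apply, F1, MonoidHom.mem_ker.1 x.2, ← dihRot_zero]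
      rfl
    · rintro ⟨x, hx⟩
      rw [MonoidHom.mem_ker, MonoidHom.mk'_apply, ← dihRot_zero] at hx
      obtain ⟨a, rfl⟩ | ⟨a, rfl⟩ := hcases x
      · rw [F1] at hx
        exact ⟨⟨a, MonoidHom.mem_ker.2 (dihRot_injective hx)⟩, rfl⟩
      · rw [F2] at hx
        exact absurd hx.symm (dihRot_ne_dihRefl _ _)

/-- The centralizer `K` of a normal infinite cyclic subgroup of finite index is finite-by-`ℤ`.
Either `K` is the whole group, or every element outside `K` inverts the cyclic subgroup and the
map from `K` to `ℤ` extends to the infinite dihedral group. -/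
theorem isFiniteBy_int_or_dihedral {G : Type*} [Group G] [Infinite G]
    (hG : IsVirtuallyCyclic G) :
    IsFiniteBy G (Multiplicative ℤ) ∨ IsFiniteBy G (DihedralGroup 0) := by
  obtain ⟨C₀, hcyc, hfin⟩ := hG
  -- The normal core is a normal infinite cyclic subgroup of finite index.
  set C := C₀.normalCore with hC
  have : IsCyclic C :=
    isCyclic_of_injective (Subgroup.inclusion C₀.normalCore_le) (Subgroup.inclusion_injective _)
  have hCinf : Infinite C := by
    rw [← not_finite_iff_infinite]
    intro h
    have h1 := C.card_mul_index
    have : Nat.card G ≠ 0 := by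
      rw [← h1]
      exact mul_ne_zero Nat.card_pos.ne' Subgroup.FiniteIndex.index_ne_zero
    exact this Nat.card_eq_zero_of_infinite
  obtain ⟨c, hc⟩ := (Subgroup.isCyclic_iff_exists_zpowers_eq_top C).1 ‹_›
  have hinj : Function.Injective (fun n : ℤ => c ^ n) := by
    rw [injective_zpow_iff_not_isOfFinOrder, ← infinite_zpowers, hc]
    exact Set.infinite_coe_iff.1 hCinf
  have hcC : c ∈ C := hc ▸ Subgroup.mem_zpowers c
  set K := Subgroup.centralizer ({c} : Set G) with hKdef
  have hmemK (x : G) : x ∈ K ↔ x * c * x⁻¹ = c := by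
    rw [hKdef, Subgroup.mem_centralizer_singleton_iff, mul_inv_eq_iff_eq_mul]
  have hCK : C ≤ K := by
    intro x hx
    rw [← hc] at hx
    obtain ⟨n, rfl⟩ := hx
    rw [hmemK]; group
  -- Conjugation acts on `C` by an automorphism of `ℤ`, hence trivially or by inversion.
  have hinv (g : G) (hg : g ∉ K) : g * c * g⁻¹ = c⁻¹ := by
    have h1 (g : G) : ∃ a : ℤ, c ^ a = g * c * g⁻¹ := by
      have : g * c * g⁻¹ ∈ C := Subgroup.Normal.conj_mem inferInstance c hcC g
      rw [← hc] at this
      exact this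
    obtain ⟨a, ha⟩ := h1 g
    obtain ⟨b, hb⟩ := h1 g⁻¹
    have h2 : c ^ (a * b) = c ^ (1 : ℤ) := by
      rw [zpow_mul, ha, conj_zpow, hb]; group
    have h3 : a * b = 1 := hinj h2
    obtain h | h := Int.eq_one_or_neg_one_of_mul_eq_one h3
    · rw [h, zpow_one] at ha
      exact absurd ((hmemK g).2 ha.symm) hg
    · rw [← ha, h, zpow_neg_one]
  have hCK' : IsFiniteBy K (Multiplicative ℤ) := by
    have e := Subgroup.subgroupOfEquivOfLe hCK
    have : IsCyclic (C.subgroupOf K) := isCyclic_of_injective (e : _ →* C) e.injective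
    have : Infinite (C.subgroupOf K) := Infinite.of_injective e.symm e.symm.injective
    refine isFiniteBy_int_of_le_center (C.subgroupOf K) ?_
    rintro ⟨x, hxK⟩ hx
    rw [Subgroup.mem_subgroupOf, ← hc] at hx
    obtain ⟨n, hn⟩ := hx
    rw [Subgroup.mem_center_iff]
    rintro ⟨y, hy⟩
    have h1 : Commute y c := by
      have := (hmemK y).1 hy
      rwa [mul_inv_eq_iff_eq_mul] at this
    refine Subtype.ext ?_
    change y * x = x * y
    rw [← show c ^ n = x from hn]
    exact (h1.zpow_right n)
  by_cases hKtop : K = ⊤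
  · left
    obtain ⟨f, hf, hker⟩ := hCK'
    let e : G ≃* K := (Subgroup.topEquiv.symm).trans (MulEquiv.subgroupCongr hKtop.symm)
    refine ⟨f.comp (e : G →* K), hf.comp e.surjective, ?_⟩
    refine Finite.of_injective (fun x : (f.comp (e : G →* K)).ker => (⟨e x, x.2⟩ : f.ker)) ?_
    intro x y h
    exact Subtype.ext (e.injective (congrArg Subtype.val h))
  · right
    obtain ⟨s, hs⟩ : ∃ s, s ∉ K := by
      by_contra! h
      exact hKtop (eq_top_iff.2 fun x _ => h x)
    obtain ⟨f, hf, hker⟩ := hCK'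
    have hsinv : s⁻¹ * c * s = c⁻¹ := by
      have := hinv s⁻¹ (by rwa [inv_mem_iff])
      rwa [inv_inv] at this
    refine isFiniteBy_dihedral_of_inverting K f hf hker s hs ?_ ?_
    · intro x hx
      rw [hmemK]
      have h1 := hinv x hx
      calc s⁻¹ * x * c * (s⁻¹ * x)⁻¹ = s⁻¹ * (x * c * x⁻¹) * s := by group
        _ = (s⁻¹ * c * s)⁻¹ := by rw [h1]; group
        _ = c := by rw [hsinv, inv_inv]
    · intro x
      have hx := (hmemK x).1 x.2
      have hmem : s⁻¹ * x * s ∈ K := by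
        rw [hmemK]
        have h1 : s * c * s⁻¹ = c⁻¹ := hinv s hs
        calc s⁻¹ * x * s * c * (s⁻¹ * x * s)⁻¹
            = s⁻¹ * (x * (s * c * s⁻¹) * (x : G)⁻¹) * s := by group
          _ = s⁻¹ * (x * c * (x : G)⁻¹)⁻¹ * s := by rw [h1]; group
          _ = (s⁻¹ * c * s)⁻¹ := by rw [hx]; group
          _ = c := by rw [hsinv, inv_inv]
      refine ⟨hmem, ?_⟩
      -- Some power of `x` lies in `C`, where conjugation by `s` is inversion, and
      -- roots in `Multiplicative ℤ` are unique.
      have hpow : (x : G) ^ C.index ∈ C := Subgroup.pow_index_mem C _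
      obtain ⟨n, hn⟩ : ∃ n : ℤ, c ^ n = (x : G) ^ C.index :=
        Subgroup.mem_zpowers_iff.1 (hc.symm ▸ hpow)
      have hindex : C.index ≠ 0 := Subgroup.FiniteIndex.index_ne_zero
      refine pow_left_injective hindex ?_
      change f _ ^ C.index = (f x)⁻¹ ^ C.index
      rw [← map_inv, ← map_pow, ← map_pow]
      congr 1
      refine Subtype.ext ?_
      change (s⁻¹ * x * s) ^ C.index = (x : G)⁻¹ ^ C.index
      have h1 : (s⁻¹ * x * s) ^ C.index = s⁻¹ * (x : G) ^ C.index * s := by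
        simpa using conj_pow (a := s⁻¹) (b := (x : G)) (i := C.index)
      have h2 : s⁻¹ * c ^ n * s = (s⁻¹ * c * s) ^ n := by
        simpa using (conj_zpow (a := s⁻¹) (b := c) (i := n)).symm
      rw [h1, inv_pow, ← hn, h2, hsinv, inv_zpow]

/-! ### Maximal growth under homomorphisms with finite kernel -/

/-- A set with fewer than `k` elements can be enlarged to one with `k` elements, so its powers
also count towards `maxGrowth G k`. -/
theorem ncard_pow_le_maxGrowth_of_card_le {G : Type*} [Group G] [Infinite G] {k : ℕ} (n : ℕ)
    (S : Finset G) (hS : S.card ≤ k) : ((S : Set G) ^ n).ncard ≤ maxGrowth G k n := by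
  classical
  obtain ⟨T, hST, hT⟩ := Infinite.exists_superset_card_eq S k hS
  refine le_trans (Set.ncard_le_ncard (Set.pow_subset_pow_left (by exact_mod_cast hST)) ?_)
    ((isGreatest_maxGrowth G k n).2 ⟨T, hT, rfl⟩)
  rw [← Finset.coe_pow]
  exact Finset.finite_toSet _

theorem maxGrowth_le_card_ker_mul {G H : Type*} [Group G] [Group H] [Infinite G] [Infinite H]
    (f : G →* H) [Finite f.ker] (k n : ℕ) :
    maxGrowth G k n ≤ Nat.card f.ker * maxGrowth H k n := by
  classical
  obtain ⟨S, hS, hm⟩ := (isGreatest_maxGrowth G k n).1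
  rw [hm]
  have h1 : ((S : Set G) ^ n).ncard = (S ^ n).card := by
    rw [← Finset.coe_pow, Set.ncard_coe_finset]
  have h2 : (((S.image f : Finset H) : Set H) ^ n).ncard = ((S ^ n).image f).card := by
    rw [← Finset.coe_pow, Set.ncard_coe_finset, Finset.image_pow]
  have h3 := ncard_pow_le_maxGrowth_of_card_le n (S.image f) (hS ▸ Finset.card_image_le)
  rw [h2] at h3
  rw [h1]
  refine le_trans (Finset.card_le_mul_card_image (f := f) _ (Nat.card f.ker) ?_)
    (Nat.mul_le_mul_left _ h3)
  intro b hb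
  obtain ⟨a, -, rfl⟩ := Finset.mem_image.1 hb
  rw [← Nat.card_eq_finsetCard]
  refine Nat.card_le_card_of_injective
    -- A fibre of `f` is a translate of a subset of the kernel.
    (fun x : {x // x ∈ (S ^ n).filter (fun y => f y = f a)} => (⟨a⁻¹ * x, ?_⟩ : f.ker)) ?_
  · rw [MonoidHom.mem_ker, map_mul, map_inv, (Finset.mem_filter.1 x.2).2, inv_mul_cancel]
  · intro x y h
    exact Subtype.ext (mul_left_cancel (congrArg Subtype.val h))

theorem maxGrowth_le_of_surjective {G H : Type*} [Group G] [Group H] [Infinite G] [Infinite H]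
    (f : G →* H) (hf : Function.Surjective f) (k n : ℕ) :
    maxGrowth H k n ≤ maxGrowth G k n := by
  classical
  obtain ⟨T, hT, hm⟩ := (isGreatest_maxGrowth H k n).1
  let S : Finset G := T.image (Function.surjInv hf)
  have hST : S.image f = T := by
    ext x
    simp [S, Function.surjInv_eq]
  have hfin : ((S : Set G) ^ n).Finite := by
    rw [← Finset.coe_pow]
    exact Finset.finite_toSet _
  rw [hm]
  calc ((T : Set H) ^ n).ncard = (f '' ((S : Set G) ^ n)).ncard := by
        rw [Set.image_pow, ← Finset.coe_image, hST]
    _ ≤ ((S : Set G) ^ n).ncard := Set.ncard_image_le hfin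
    _ ≤ _ := ncard_pow_le_maxGrowth_of_card_le n S (hT ▸ Finset.card_image_le)

theorem maxGrowth_int_le_maxGrowth_dihedral (k n : ℕ) :
    maxGrowth (Multiplicative ℤ) k n ≤ maxGrowth (DihedralGroup 0) k n := by
  have hker : dihRotHom.ker = ⊥ := (MonoidHom.ker_eq_bot_iff _).2 fun _ _ h => dihRot_injective h
  have : Finite dihRotHom.ker := by rw [hker]; infer_instance
  simpa [hker] using maxGrowth_le_card_ker_mul dihRotHom k n

/-! ### The infinite cyclic group -/

theorem Multiset.prod_mem_set_pow {M : Type*} [CommMonoid M] {S : Set M} (m : Multiset M)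
    (h : ∀ x ∈ m, x ∈ S) : m.prod ∈ S ^ Multiset.card m := by
  induction m using Multiset.induction_on with
  | empty => simp
  | cons a m ih =>
    rw [Multiset.prod_cons, Multiset.card_cons, pow_succ']
    exact Set.mul_mem_mul (h a (by simp)) (ih fun x hx => h x (by simp [hx]))

/-- Uniqueness of base-`M` expansions, for differences of digit sequences. -/
theorem eq_zero_of_sum_mul_pow_eq_zero {k : ℕ} {M : ℤ} (w : Fin k → ℤ)
    (hw : ∀ i, |w i| < M) (h : ∑ i, w i * M ^ (i : ℕ) = 0) : w = 0 := by
  induction k with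
  | zero => exact Subsingleton.elim _ _
  | succ k ih =>
    rw [Fin.sum_univ_succ] at h
    have h1 : ∑ i : Fin k, w i.succ * M ^ (i.succ : ℕ)
        = M * ∑ i : Fin k, w i.succ * M ^ (i : ℕ) := by
      rw [Finset.mul_sum]
      refine Finset.sum_congr rfl fun i _ => ?_
      rw [Fin.val_succ, pow_succ]; ring
    rw [h1] at h
    have h0 : w 0 = 0 := by
      refine Int.eq_zero_of_abs_lt_dvd (m := M) ?_ (hw 0)
      exact ⟨-∑ i : Fin k, w i.succ * M ^ (i : ℕ), by simp at h; linarith⟩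
    have hM : M ≠ 0 := ((abs_nonneg _).trans_lt (hw 0)).ne'
    have h2 : ∑ i : Fin k, w i.succ * M ^ (i : ℕ) = 0 := by
      simpa [h0, hM] using h
    have h3 := ih (fun i => w i.succ) (fun i => hw _) h2
    funext i
    refine Fin.cases h0 (fun j => congrFun h3 j) i

/-- The powers of `2 * n + 2` admit no coincidence between integer combinations with coefficients
bounded by `n`; they serve as generic integers below. -/
theorem eq_of_sum_mul_pow_eq {k n : ℕ} {u v : Fin k → ℤ} (hu : ∀ i, |u i| ≤ n)
    (hv : ∀ i, |v i| ≤ n)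
    (h : ∑ i, u i * (2 * n + 2 : ℤ) ^ (i : ℕ) = ∑ i, v i * (2 * n + 2 : ℤ) ^ (i : ℕ)) :
    u = v := by
  rw [← sub_eq_zero]
  refine eq_zero_of_sum_mul_pow_eq_zero (M := 2 * n + 2) (u - v) (fun i => ?_) ?_
  · have := abs_sub (u i) (v i)
    have h1 := hu i
    have h2 := hv i
    rw [Pi.sub_apply]
    linarith
  · simp [sub_mul, Finset.sum_sub_distrib, h]

/-- In a commutative group a product of `n` elements of `S` depends only on the multiset of its
factors. -/
theorem maxGrowth_int_le_multichoose (k n : ℕ) :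
    maxGrowth (Multiplicative ℤ) k n ≤ k.multichoose n := by
  classical
  obtain ⟨S, hS, hm⟩ := (isGreatest_maxGrowth (Multiplicative ℤ) k n).1
  rw [hm]
  have hsub : (S : Set (Multiplicative ℤ)) ^ n ⊆
      Set.range fun s : Sym S n => ((s : Multiset S).map Subtype.val).prod := by
    intro a ha
    obtain ⟨f, rfl⟩ := Set.mem_pow.1 ha
    refine ⟨⟨(List.ofFn f : Multiset S), by simp⟩, ?_⟩
    simp [List.map_ofFn, Function.comp_def]
  refine (Set.ncard_le_ncard hsub (Set.finite_range _)).trans ?_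
  rw [← Nat.card_coe_set_eq]
  refine (Finite.card_range_le _).trans ?_
  rw [Nat.card_eq_fintype_card, Sym.card_sym_eq_multichoose, Fintype.card_coe, hS]

/-- For the set of powers `(2 * n + 2) ^ i`, distinct multisets of `n` factors have distinct
products. -/
theorem multichoose_le_maxGrowth_int (k n : ℕ) :
    k.multichoose n ≤ maxGrowth (Multiplicative ℤ) k n := by
  classical
  let t : Fin k → Multiplicative ℤ := fun i => Multiplicative.ofAdd ((2 * n + 2 : ℤ) ^ (i : ℕ))
  let S : Finset (Multiplicative ℤ) := Finset.univ.image t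
  have hS : S.card ≤ k := Finset.card_image_le.trans (by simp)
  refine le_trans ?_ (ncard_pow_le_maxGrowth_of_card_le n S hS)
  let F : Sym (Fin k) n → Multiplicative ℤ := fun s => ((s : Multiset (Fin k)).map t).prod
  -- The multiplicities of the factors are the digits of the sum in base `2 * n + 2`.
  have hF (s : Sym (Fin k) n) : (F s).toAdd =
      ∑ i, ((s : Multiset (Fin k)).count i : ℤ) * (2 * n + 2 : ℤ) ^ (i : ℕ) := by
    have h1 : F s = ∏ i, t i ^ (s : Multiset (Fin k)).count i := by
      rw [show F s = ((s : Multiset (Fin k)).map t).prod from rfl,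
        Finset.prod_multiset_map_count]
      refine Finset.prod_subset (Finset.subset_univ _) fun i _ hi => ?_
      rw [Multiset.count_eq_zero_of_notMem (by simpa using hi), pow_zero]
    rw [h1, toAdd_prod]
    simp [t]
  have hinj : Function.Injective F := by
    intro s s' h
    have h1 := congrArg Multiplicative.toAdd h
    rw [hF, hF] at h1
    have hc (s : Sym (Fin k) n) (i : Fin k) :
        |((s : Multiset (Fin k)).count i : ℤ)| ≤ n := by
      rw [abs_of_nonneg (by positivity)]
      have := Multiset.count_le_card i (s : Multiset (Fin k))
      exact_mod_cast this.trans_eq s.2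
    have h2 := eq_of_sum_mul_pow_eq (hc s) (hc s') h1
    refine Subtype.ext (Multiset.ext' fun i => ?_)
    exact_mod_cast congrFun h2 i
  have hsub : Set.range F ⊆ (S : Set (Multiplicative ℤ)) ^ n := by
    rintro _ ⟨s, rfl⟩
    have h1 := Multiset.prod_mem_set_pow (S := (S : Set (Multiplicative ℤ)))
      ((s : Multiset (Fin k)).map t) (by
        intro x hx
        obtain ⟨i, -, rfl⟩ := Multiset.mem_map.1 hx
        simp [S])
    rwa [Multiset.card_map, show Multiset.card (s : Multiset (Fin k)) = n from s.2] at h1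
  have hfin : ((S : Set (Multiplicative ℤ)) ^ n).Finite := by
    rw [← Finset.coe_pow]
    exact Finset.finite_toSet _
  refine le_trans (le_of_eq ?_) (Set.ncard_le_ncard hsub hfin)
  rw [← Nat.card_coe_set_eq, Nat.card_range_of_injective hinj, Nat.card_eq_fintype_card,
    Sym.card_sym_eq_multichoose, Fintype.card_fin]

/-! ### Counting lattice points in `ℓ¹` balls -/

/-- The set of integer vectors of length `d` with `ℓ¹` norm at most `n`. -/
def l1Ball (d n : ℕ) : Set (Fin d → ℤ) := {v | ∑ i, |v i| ≤ n}

theorem abs_le_of_mem_l1Ball {d n : ℕ} {v : Fin d → ℤ} (hv : v ∈ l1Ball d n) (i : Fin d) :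
    |v i| ≤ n :=
  (Finset.single_le_sum (f := fun i => |v i|) (fun _ _ => abs_nonneg _)
    (Finset.mem_univ i)).trans hv

theorem finite_l1Ball (d n : ℕ) : (l1Ball d n).Finite :=
  (Set.finite_Icc (fun _ : Fin d => -(n : ℤ)) (fun _ => (n : ℤ))).subset fun _ hv =>
    ⟨fun i => (abs_le.1 (abs_le_of_mem_l1Ball hv i)).1,
      fun i => (abs_le.1 (abs_le_of_mem_l1Ball hv i)).2⟩

theorem l1Ball_subset_l1Ball_succ (d n : ℕ) : l1Ball d n ⊆ l1Ball d (n + 1) := by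
  intro v hv
  have hv : ∑ i, |v i| ≤ (n : ℤ) := hv
  change ∑ i, |v i| ≤ ((n + 1 : ℕ) : ℤ)
  push_cast
  linarith

theorem cons_mem_l1Ball {d n : ℕ} (x : ℤ) (v : Fin d → ℤ) :
    (Fin.cons x v : Fin (d + 1) → ℤ) ∈ l1Ball (d + 1) n ↔ |x| + ∑ i, |v i| ≤ n := by
  simp [l1Ball, Fin.sum_univ_succ]

/-- The number of lattice points in an `ℓ¹` ball is a Delannoy number. The upper limit `N` of the
sum is left free, as the terms with `j > d` vanish. -/
theorem ncard_l1Ball_zero_left (n : ℕ) : (l1Ball 0 n).ncard = 1 := by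
  rw [Set.ncard_eq_one]
  exact ⟨0, by ext v; simp [l1Ball, Subsingleton.elim v 0]⟩

theorem ncard_l1Ball_zero_right (d : ℕ) : (l1Ball d 0).ncard = 1 := by
  rw [Set.ncard_eq_one]
  refine ⟨0, ?_⟩
  ext v
  constructor
  · intro hv
    funext i
    simpa using abs_le_of_mem_l1Ball hv i
  · rintro rfl
    simp [l1Ball]

/-- The Delannoy recurrence for the number of lattice points in `ℓ¹` balls. -/
theorem ncard_l1Ball_succ_succ (d n : ℕ) : (l1Ball (d + 1) (n + 1)).ncard =
    (l1Ball d (n + 1)).ncard + (l1Ball (d + 1) n).ncard + (l1Ball d n).ncard := by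
  -- The vectors split by their first coordinate: `0`; anything but `0` and `-1`, in bijection
  -- with the vectors of norm at most `n` by `push`; and `-1`.
  let push : ℤ → ℤ := fun x => if 0 ≤ x then x + 1 else x - 1
  have hpush (x : ℤ) : |push x| = |x| + 1 := by
    simp only [push]
    split_ifs with h
    · rw [abs_of_nonneg h, abs_of_nonneg (by omega)]
    · rw [abs_of_neg (by omega), abs_of_neg (by omega)]; ring
  have hpushinj : Function.Injective push := by
    intro x y h
    simp only [push] at h
    split_ifs at h <;> omega
  let α : (Fin d → ℤ) → (Fin (d + 1) → ℤ) := Fin.cons (α := fun _ => ℤ) 0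
  let β : (Fin (d + 1) → ℤ) → (Fin (d + 1) → ℤ) := fun v => Fin.cons (push (v 0)) (Fin.tail v)
  let γ : (Fin d → ℤ) → (Fin (d + 1) → ℤ) := Fin.cons (α := fun _ => ℤ) (-1)
  have hα : Function.Injective α := Fin.cons_right_injective _
  have hγ : Function.Injective γ := Fin.cons_right_injective _
  have hβ : Function.Injective β := by
    intro u v h
    obtain ⟨h1, h2⟩ := Fin.cons_inj.1 h
    rw [← Fin.cons_self_tail u, ← Fin.cons_self_tail v, hpushinj h1, h2]
  have hunion : l1Ball (d + 1) (n + 1) =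
      (α '' l1Ball d (n + 1) ∪ β '' l1Ball (d + 1) n) ∪ γ '' l1Ball d n := by
    ext v
    constructor
    · refine Fin.consCases (fun x w => ?_) v
      intro hv
      rw [cons_mem_l1Ball] at hv
      push_cast at hv
      by_cases h0 : x = 0
      · exact .inl (.inl ⟨w, by simpa [l1Ball, h0] using hv, by simp [α, h0]⟩)
      by_cases h1 : x = -1
      · refine .inr ⟨w, ?_, by simp [γ, h1]⟩
        simp [h1] at hv
        change ∑ i, |w i| ≤ _
        linarith
      · refine .inl (.inr ?_)
        obtain ⟨y, hy⟩ : ∃ y, push y = x := by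
          obtain h | h := lt_or_gt_of_ne h0
          · exact ⟨x + 1, by simp only [push]; rw [if_neg (by omega)]; ring⟩
          · exact ⟨x - 1, by simp only [push]; rw [if_pos (by omega)]; ring⟩
        refine ⟨Fin.cons y w, ?_, by simp [β, hy]⟩
        rw [← hy, hpush] at hv
        rw [cons_mem_l1Ball]
        linarith
    · rintro ((⟨w, hw, rfl⟩ | ⟨w, hw, rfl⟩) | ⟨w, hw, rfl⟩)
      · simp only [α]
        rw [cons_mem_l1Ball, abs_zero, zero_add]
        exact hw
      · simp only [β]
        rw [cons_mem_l1Ball, hpush]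
        rw [← Fin.cons_self_tail w, cons_mem_l1Ball] at hw
        push_cast
        linarith
      · simp only [γ]
        rw [cons_mem_l1Ball]
        have hw : ∑ i, |w i| ≤ (n : ℤ) := hw
        simp
        linarith
  have hdisj1 : Disjoint (α '' l1Ball d (n + 1)) (β '' l1Ball (d + 1) n) := by
    rw [Set.disjoint_left]
    rintro _ ⟨u, -, rfl⟩ ⟨v, -, h⟩
    have h1 := congrArg (|·|) (Fin.cons_inj.1 h).1
    simp only [hpush, abs_zero] at h1
    have := abs_nonneg (v 0)
    omega
  have hdisj2 : Disjoint (α '' l1Ball d (n + 1) ∪ β '' l1Ball (d + 1) n) (γ '' l1Ball d n) := by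
    rw [Set.disjoint_left]
    rintro _ (⟨u, -, rfl⟩ | ⟨u, -, rfl⟩) ⟨v, -, h⟩
    · exact absurd (Fin.cons_inj.1 h).1 (by decide)
    · have h1 := (Fin.cons_inj.1 h).1
      simp only [push] at h1
      split_ifs at h1 <;> omega
  have fα := (finite_l1Ball d (n + 1)).image α
  have fβ := (finite_l1Ball (d + 1) n).image β
  have fγ := (finite_l1Ball d n).image γ
  rw [hunion, Set.ncard_union_eq hdisj2 (fα.union fβ) fγ, Set.ncard_union_eq hdisj1 fα fβ,
    Set.ncard_image_of_injective _ hα, Set.ncard_image_of_injective _ hβ,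
    Set.ncard_image_of_injective _ hγ]

theorem ncard_l1Ball (d n N : ℕ) (hN : d < N) : (l1Ball d n).ncard =
    ∑ j ∈ Finset.range N, d.choose j * n.choose j * 2 ^ j := by
  induction d generalizing n N with
  | zero =>
    obtain ⟨N, rfl⟩ := Nat.exists_eq_succ_of_ne_zero hN.ne'
    rw [ncard_l1Ball_zero_left, Nat.succ_eq_add_one, Finset.sum_range_succ']
    simp
  | succ d ihd =>
    induction n generalizing N with
    | zero =>
      obtain ⟨N, rfl⟩ := Nat.exists_eq_succ_of_ne_zero (Nat.ne_zero_of_lt hN)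
      rw [ncard_l1Ball_zero_right, Nat.succ_eq_add_one, Finset.sum_range_succ']
      simp
    | succ n ihn =>
      obtain ⟨N, rfl⟩ := Nat.exists_eq_succ_of_ne_zero (Nat.ne_zero_of_lt hN)
      have hN' : d < N := by omega
      have h1 := ihd n N hN'
      have h2 := ihd n (N + 1) (by omega)
      rw [ncard_l1Ball_succ_succ, ihd (n + 1) (N + 1) (by omega), ihn (N + 1) hN]
      simp only [Nat.succ_eq_add_one, Finset.sum_range_succ' _ N, Nat.choose_succ_succ,
        Nat.choose_zero_right, pow_zero, pow_succ] at h2 ⊢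
      -- The two sides of the recurrence differ by a telescoping sum.
      have h3 : ∑ j ∈ Finset.range N, (d.choose j + d.choose (j + 1)) *
          (n.choose j + n.choose (j + 1)) * (2 ^ j * 2) =
          ∑ j ∈ Finset.range N, d.choose (j + 1) * (n.choose j + n.choose (j + 1)) * (2 ^ j * 2)
          + ∑ j ∈ Finset.range N,
            (d.choose j + d.choose (j + 1)) * n.choose (j + 1) * (2 ^ j * 2)
          + 2 * ∑ j ∈ Finset.range N, d.choose j * n.choose j * 2 ^ j
          - ∑ j ∈ Finset.range N, d.choose (j + 1) * n.choose (j + 1) * (2 ^ j * 2) := by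
        refine Nat.eq_sub_of_add_eq ?_
        rw [Finset.mul_sum, ← Finset.sum_add_distrib, ← Finset.sum_add_distrib,
          ← Finset.sum_add_distrib]
        exact Finset.sum_congr rfl fun j _ => by ring
      have h4 : ∑ j ∈ Finset.range N, d.choose (j + 1) * n.choose (j + 1) * (2 ^ j * 2)
          ≤ 2 * ∑ j ∈ Finset.range N, d.choose j * n.choose j * 2 ^ j := by
        omega
      rw [h3]
      omega

theorem ncard_l1Ball_self_eq (n : ℕ) : ((l1Ball n n).ncard : ℝ) =
    ∑ j ∈ Finset.range (n + 1), (n.choose j * Real.sqrt 2 ^ j) ^ 2 := by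
  rw [ncard_l1Ball n n (n + 1) n.lt_succ_self, Nat.cast_sum]
  refine Finset.sum_congr rfl fun j _ => ?_
  rw [mul_pow, ← pow_mul, mul_comm j 2, pow_mul, Real.sq_sqrt zero_le_two]
  push_cast
  ring

theorem sum_choose_mul_sqrt_two_pow_sq (n : ℕ) :
    (∑ j ∈ Finset.range (n + 1), n.choose j * Real.sqrt 2 ^ j) ^ 2 =
      (3 + 2 * Real.sqrt 2) ^ n := by
  have h1 : ∑ j ∈ Finset.range (n + 1), n.choose j * Real.sqrt 2 ^ j
      = (Real.sqrt 2 + 1) ^ n := by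
    rw [add_pow]
    exact Finset.sum_congr rfl fun j _ => by rw [one_pow]; ring
  have h2 : (Real.sqrt 2 + 1) ^ 2 = 3 + 2 * Real.sqrt 2 := by
    rw [add_sq, Real.sq_sqrt zero_le_two]; ring
  rw [h1, ← h2, ← pow_mul, ← pow_mul, mul_comm]

/-- The sum of the squares of nonnegative numbers is at most the square of their sum. -/
theorem ncard_l1Ball_self_le (n : ℕ) :
    ((l1Ball n n).ncard : ℝ) ≤ (3 + 2 * Real.sqrt 2) ^ n := by
  rw [ncard_l1Ball_self_eq, ← sum_choose_mul_sqrt_two_pow_sq]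
  exact Finset.sum_sq_le_sq_sum_of_nonneg fun _ _ => by positivity

/-- The Cauchy–Schwarz inequality turns the sum of squares into the square of a binomial sum, at
the cost of the factor `n + 1`. -/
theorem le_mul_ncard_l1Ball_self (n : ℕ) :
    (3 + 2 * Real.sqrt 2) ^ n ≤ (n + 1) * ((l1Ball n n).ncard : ℝ) := by
  rw [ncard_l1Ball_self_eq, ← sum_choose_mul_sqrt_two_pow_sq]
  refine sq_sum_le_card_mul_sum_sq.trans ?_
  simp

/-! ### The growth of the infinite dihedral group -/

/-- The element of the infinite dihedral group with integer parameter `c`: a rotation if `ρ = 0`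
and a reflection otherwise. -/
def dihMk (ρ c : ℤ) : DihedralGroup 0 := if ρ = 0 then dihRot c else dihRefl c

theorem exists_eq_dihMk (x : DihedralGroup 0) :
    ∃ ρ c : ℤ, (ρ = 0 ∨ ρ = 1) ∧ x = dihMk ρ c := by
  obtain ⟨n, rfl⟩ | ⟨n, rfl⟩ := exists_dihRot_or_dihRefl x
  · exact ⟨0, n, .inl rfl, by simp [dihMk]⟩
  · exact ⟨1, n, .inr rfl, by simp [dihMk]⟩

theorem dihMk_mul_dihMk {ρ σ : ℤ} (hρ : ρ = 0 ∨ ρ = 1) (hσ : σ = 0 ∨ σ = 1) (c d : ℤ) :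
    dihMk ρ c * dihMk σ d = dihMk ((1 - 2 * σ) * ρ + σ) ((1 - 2 * σ) * c + d) := by
  obtain rfl | rfl := hρ <;> obtain rfl | rfl := hσ <;>
    simp [dihMk, dihRot_mul_dihRot, dihRot_mul_dihRefl, dihRefl_mul_dihRot,
      dihRefl_mul_dihRefl] <;> congr 1 <;> ring

/-- A product of `n` elements of the infinite dihedral group is determined by an integer vector of
`ℓ¹` norm at most `n`, which counts the occurrences of each factor with sign. The coefficients of
the reflections alternate in sign and add up to `0` or `1`; without reflections all signs are
positive and the coefficients add up to `n`. -/
theorem exists_coeff_of_mem_range_dihMk_pow {ι : Type*} [Fintype ι] (ρ c : ι → ℤ)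
    (hρ : ∀ i, ρ i = 0 ∨ ρ i = 1) (n : ℕ) (g : DihedralGroup 0)
    (hg : g ∈ (Set.range fun i => dihMk (ρ i) (c i)) ^ n) :
    ∃ v : ι → ℤ, ∑ i, |v i| ≤ n ∧ (∑ i, v i * ρ i = 0 ∨ ∑ i, v i * ρ i = 1) ∧
      g = dihMk (∑ i, v i * ρ i) (∑ i, v i * c i) ∧ ((∀ i, ρ i = 0) → ∑ i, v i = n) := by
  classical
  induction n generalizing g with
  | zero =>
    refine ⟨0, by simp, by simp, ?_, by simp⟩
    rw [pow_zero] at hg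
    rw [Set.mem_one.1 hg]
    simp [dihMk, dihRot_zero]
  | succ n ih =>
    rw [pow_succ] at hg
    obtain ⟨g₀, hg₀, _, ⟨i, rfl⟩, rfl⟩ := Set.mem_mul.1 hg
    obtain ⟨v, hv, hvρ, rfl, hv0⟩ := ih g₀ hg₀
    have hsum (f : ι → ℤ) : ∑ j, ((1 - 2 * ρ i) * v j + Pi.single (M := fun _ => ℤ) i 1 j) * f j
        = (1 - 2 * ρ i) * ∑ j, v j * f j + f i := by
      simp only [add_mul, Finset.sum_add_distrib, mul_assoc, ← Finset.mul_sum]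
      congr 1
      simp [Pi.single_apply]
    -- Multiplying by a reflection on the right negates all previous coefficients.
    refine ⟨fun j => (1 - 2 * ρ i) * v j + Pi.single (M := fun _ => ℤ) i 1 j, ?_, ?_, ?_, ?_⟩
    · have habs : |1 - 2 * ρ i| = 1 := by
        obtain h | h := hρ i <;> simp [h]
      calc ∑ j, |(1 - 2 * ρ i) * v j + Pi.single (M := fun _ => ℤ) i 1 j|
          ≤ ∑ j, (|v j| + Pi.single (M := fun _ => ℤ) i 1 j) := by
            refine Finset.sum_le_sum fun j _ => (abs_add_le _ _).trans (le_of_eq ?_)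
            rw [abs_mul, habs, one_mul]
            congr 1
            rw [Pi.single_apply]
            split_ifs <;> simp
        _ ≤ (n + 1 : ℕ) := by
            rw [Finset.sum_add_distrib]
            simpa using hv
    · rw [hsum]
      obtain h | h := hρ i <;> obtain h' | h' := hvρ <;> simp [h, h']
    · rw [dihMk_mul_dihMk hvρ (hρ i), hsum, hsum]
    · intro h
      have h1 := hsum (fun _ => 1)
      simp only [mul_one] at h1
      rw [h1, hv0 h, h i]
      push_cast
      ring

theorem exists_range_dihMk_eq {k : ℕ} (S : Finset (DihedralGroup 0)) (hS : S.card = k) :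
    ∃ ρ c : Fin k → ℤ, (∀ i, ρ i = 0 ∨ ρ i = 1) ∧
      (S : Set (DihedralGroup 0)) = Set.range fun i => dihMk (ρ i) (c i) := by
  choose ρ c hρ hx using exists_eq_dihMk
  let e := S.equivFinOfCardEq hS
  refine ⟨fun i => ρ (e.symm i), fun i => c (e.symm i), fun i => hρ _, ?_⟩
  simp only [← hx]
  ext x
  constructor
  · intro h
    exact ⟨e ⟨x, h⟩, by simp⟩
  · rintro ⟨i, rfl⟩
    exact (e.symm i).2

/-- The coefficient vector of a product lies on one of at most two parallel hyperplanes, which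
reduces the number of free coordinates to one less than the number of generators. -/
theorem maxGrowth_dihedral_le_ncard_l1Ball (k n : ℕ) :
    maxGrowth (DihedralGroup 0) k n ≤ (l1Ball k n).ncard := by
  obtain ⟨S, hS, hm⟩ := (isGreatest_maxGrowth (DihedralGroup 0) k n).1
  obtain ⟨ρ, c, hρ, hS⟩ := exists_range_dihMk_eq S hS
  rw [hm, hS]
  refine (Set.ncard_le_ncard (t := (fun v : Fin k → ℤ =>
    dihMk (∑ i, v i * ρ i) (∑ i, v i * c i)) '' l1Ball k n) ?_
    ((finite_l1Ball k n).image _)).trans (Set.ncard_image_le (finite_l1Ball k n))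
  intro g hg
  obtain ⟨v, hv, -, rfl, -⟩ := exists_coeff_of_mem_range_dihMk_pow ρ c hρ n g hg
  exact ⟨v, hv, rfl⟩

/-- A coordinate whose coefficient in a linear form is `1` is determined by the other coordinates
and the value of the form. -/
theorem ncard_setOf_abs_le_sum_mul_mem_le (m n : ℕ) (μ : Fin (m + 1) → ℤ) (j : Fin (m + 1))
    (hj : μ j = 1) (A : Finset ℤ) :
    {v : Fin (m + 1) → ℤ | (∀ i, |v i| ≤ n) ∧ ∑ i, v i * μ i ∈ A}.Finite ∧
    {v : Fin (m + 1) → ℤ | (∀ i, |v i| ≤ n) ∧ ∑ i, v i * μ i ∈ A}.ncard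
      ≤ (2 * n + 1) ^ m * A.card := by
  let V := {v : Fin (m + 1) → ℤ | (∀ i, |v i| ≤ n) ∧ ∑ i, v i * μ i ∈ A}
  let P : Finset ((Fin m → ℤ) × ℤ) :=
    (Fintype.piFinset fun _ => Finset.Icc (-(n : ℤ)) n) ×ˢ A
  let Φ : (Fin (m + 1) → ℤ) → (Fin m → ℤ) × ℤ := fun v =>
    (fun i => v (j.succAbove i), ∑ i, v i * μ i)
  have hmaps : ∀ v ∈ V, Φ v ∈ (P : Set ((Fin m → ℤ) × ℤ)) := by
    rintro v ⟨hv, hvA⟩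
    simp only [P, Φ, Finset.mem_coe, Finset.mem_product, Fintype.mem_piFinset, Finset.mem_Icc]
    exact ⟨fun i => abs_le.1 (hv _), hvA⟩
  have hinj : Function.Injective Φ := by
    intro u v h
    have h1 : ∀ i, u (j.succAbove i) = v (j.succAbove i) := congrFun (congrArg Prod.fst h)
    have h2 : ∑ i, u i * μ i = ∑ i, v i * μ i := congrArg Prod.snd h
    rw [Fin.sum_univ_succAbove _ j, Fin.sum_univ_succAbove _ j, hj] at h2
    simp only [h1, mul_one, add_left_inj] at h2
    funext i
    obtain rfl | ⟨i, rfl⟩ := Fin.eq_self_or_eq_succAbove j i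
    · exact h2
    · exact h1 i
  refine ⟨Set.Finite.of_finite_image (P.finite_toSet.subset (Set.image_subset_iff.2 hmaps))
    hinj.injOn, ?_⟩
  refine (Set.ncard_le_ncard_of_injOn Φ hmaps hinj.injOn P.finite_toSet).trans (le_of_eq ?_)
  rw [Set.ncard_coe_finset, Finset.card_product, Fintype.card_piFinset_const, Int.card_Icc]
  congr 2
  omega

theorem maxGrowth_dihedral_le (m n : ℕ) :
    maxGrowth (DihedralGroup 0) (m + 1) n ≤ 2 * (2 * n + 1) ^ m := by
  obtain ⟨S, hS, hm⟩ := (isGreatest_maxGrowth (DihedralGroup 0) (m + 1) n).1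
  obtain ⟨ρ, c, hρ, hS⟩ := exists_range_dihMk_eq S hS
  rw [hm, hS]
  have key (μ : Fin (m + 1) → ℤ) (j : Fin (m + 1)) (hj : μ j = 1) (A : Finset ℤ)
      (hA : A.card ≤ 2)
      (h : ∀ v : Fin (m + 1) → ℤ, (∑ i, v i * ρ i = 0 ∨ ∑ i, v i * ρ i = 1) →
        ((∀ i, ρ i = 0) → ∑ i, v i = n) → ∑ i, v i * μ i ∈ A) :
      ((Set.range fun i => dihMk (ρ i) (c i)) ^ n).ncard ≤ 2 * (2 * n + 1) ^ m := by
    obtain ⟨hfin, hcard⟩ := ncard_setOf_abs_le_sum_mul_mem_le m n μ j hj A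
    refine (Set.ncard_le_ncard ?_ (hfin.image (fun v : Fin (m + 1) → ℤ =>
      dihMk (∑ i, v i * ρ i) (∑ i, v i * c i)))).trans ((Set.ncard_image_le hfin).trans
        (hcard.trans ?_))
    · intro g hg
      obtain ⟨v, hv, hv1, rfl, hv2⟩ := exists_coeff_of_mem_range_dihMk_pow ρ c hρ n g hg
      exact ⟨v, ⟨abs_le_of_mem_l1Ball hv, h v hv1 hv2⟩, rfl⟩
    · rw [mul_comm]
      exact Nat.mul_le_mul_right _ hA
  by_cases h0 : ∀ i, ρ i = 0
  -- The linear form is the sum over all coefficients if there are no reflections, and the sum over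
  -- the coefficients of the reflections otherwise.
  · exact key (fun _ => 1) 0 rfl {(n : ℤ)} (by simp) fun v _ h => by simpa using h h0
  · push Not at h0
    obtain ⟨j, hj⟩ := h0
    exact key ρ j ((hρ j).resolve_left hj) {0, 1} (by simp) fun v h _ => by simpa using h

theorem dihRot_sum_mem_pow {ι : Type*} {S : Set (DihedralGroup 0)} (t : ι → ℤ)
    (ht : ∀ i, dihRot (t i) ∈ S) (u : ι → ℕ) (s : Finset ι) :
    dihRot (∑ i ∈ s, u i * t i) ∈ S ^ ∑ i ∈ s, u i := by
  classical
  induction s using Finset.induction_on with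
  | empty => simp [dihRot_zero]
  | insert i s hi ih =>
    rw [Finset.sum_insert hi, Finset.sum_insert hi, ← dihRot_mul_dihRot, pow_add]
    refine Set.mul_mem_mul ?_ ih
    have : dihRot (u i * t i) = dihRot (t i) ^ u i := by
      have := map_pow dihRotHom (Multiplicative.ofAdd (t i)) (u i)
      rw [← ofAdd_nsmul, nsmul_eq_mul] at this
      exact this
    rw [this]
    exact Set.pow_mem_pow (ht i)

/-- Translations by `t i` on either side of a single reflection contribute with opposite signs, so
every integer vector of `ℓ¹` norm at most `n` is realized as a coefficient vector. The identity
is included among the generators in order to fill up shorter products. -/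
theorem ncard_l1Ball_le_maxGrowth_dihedral (d n : ℕ) :
    (l1Ball d n).ncard ≤ maxGrowth (DihedralGroup 0) (d + 2) (n + 1) := by
  classical
  let t : Fin d → ℤ := fun i => (2 * n + 2 : ℤ) ^ (i : ℕ)
  let S : Finset (DihedralGroup 0) := insert 1 (insert (dihRefl 0)
    (Finset.univ.image fun i => dihRot (t i)))
  have hS : S.card ≤ d + 2 := by
    have h1 : (Finset.univ.image fun i => dihRot (t i)).card ≤ d :=
      Finset.card_image_le.trans (by simp)
    exact (Finset.card_insert_le _ _).trans
      (Nat.succ_le_succ ((Finset.card_insert_le _ _).trans (Nat.succ_le_succ h1)))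
  refine le_trans ?_ (ncard_pow_le_maxGrowth_of_card_le (n + 1) S hS)
  have hfin : ((S : Set (DihedralGroup 0)) ^ (n + 1)).Finite := by
    rw [← Finset.coe_pow]
    exact Finset.finite_toSet _
  refine Set.ncard_le_ncard_of_injOn (fun v => dihRefl (∑ i, v i * t i)) ?_ ?_ hfin
  · intro v hv
    have h1 : (1 : DihedralGroup 0) ∈ (S : Set (DihedralGroup 0)) := by simp [S]
    have h2 : dihRefl 0 ∈ (S : Set (DihedralGroup 0)) := by simp [S]
    have h3 (i : Fin d) : dihRot (t i) ∈ (S : Set (DihedralGroup 0)) := by simp [S]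
    have hneg := dihRot_sum_mem_pow t h3 (fun i => (-v i).toNat) Finset.univ
    have hpos := dihRot_sum_mem_pow t h3 (fun i => (v i).toNat) Finset.univ
    have hlen : ∑ i, (-v i).toNat + 1 + ∑ i, (v i).toNat ≤ n + 1 := by
      have h4 : ∑ i, |v i| ≤ (n : ℤ) := hv
      have h5 : ((∑ i, (-v i).toNat + ∑ i, (v i).toNat : ℕ) : ℤ) = ∑ i, |v i| := by
        rw [← Finset.sum_add_distrib, Nat.cast_sum]
        refine Finset.sum_congr rfl fun i _ => ?_
        obtain h | h := abs_cases (v i) <;> omega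
      omega
    have hmem := Set.mul_mem_mul (Set.mul_mem_mul hneg h2) hpos
    rw [← pow_succ, ← pow_add] at hmem
    have heq : dihRot (∑ i, ((-v i).toNat : ℤ) * t i) * dihRefl 0 *
        dihRot (∑ i, ((v i).toNat : ℤ) * t i) = dihRefl (∑ i, v i * t i) := by
      rw [dihRot_mul_dihRefl, dihRefl_mul_dihRot]
      congr 1
      rw [zero_sub, ← Finset.sum_neg_distrib, ← Finset.sum_add_distrib]
      refine Finset.sum_congr rfl fun i _ => ?_
      rw [← neg_mul, ← add_mul]
      congr 1
      omega
    rw [heq] at hmem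
    exact Set.pow_subset_pow_right h1 hlen hmem
  · intro u hu v hv h
    exact eq_of_sum_mul_pow_eq (abs_le_of_mem_l1Ball hu) (abs_le_of_mem_l1Ball hv)
      (dihRefl_injective h)

/-! ### Asymptotics -/

theorem limsup_rpow_one_div_eq {u : ℕ → ℕ} {A c C : ℝ} (hA : 0 < A) (hc : 0 < c) (hC : 0 < C)
    (hlow : ∀ᶠ n : ℕ in atTop, A ^ n ≤ c * n * u n)
    (hup : ∀ᶠ n : ℕ in atTop, (u n : ℝ) ≤ C * A ^ n) :
    limsup (fun n : ℕ => (((u n : ℝ) ^ (1 / (n : ℝ)) : ℝ) : EReal)) atTop = (A : EReal) := by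
  have hinv : Tendsto (fun n : ℕ => 1 / (n : ℝ)) atTop (nhds 0) :=
    tendsto_one_div_atTop_nhds_zero_nat
  have hconst (a : ℝ) (ha : 0 < a) :
      Tendsto (fun n : ℕ => a ^ (1 / (n : ℝ))) atTop (nhds 1) := by
    have := (Real.continuous_const_rpow ha.ne').tendsto 0
    rw [Real.rpow_zero] at this
    exact this.comp hinv
  have hn : Tendsto (fun n : ℕ => (n : ℝ) ^ (1 / (n : ℝ))) atTop (nhds 1) :=
    tendsto_rpow_div.comp tendsto_natCast_atTop_atTop
  have hroot (n : ℕ) (hn : 0 < n) : (A ^ n) ^ (1 / (n : ℝ)) = A := by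
    rw [one_div]
    exact Real.pow_rpow_inv_natCast hA.le hn.ne'
  have hlim : Tendsto (fun n : ℕ => (u n : ℝ) ^ (1 / (n : ℝ))) atTop (nhds A) := by
    have h1 : Tendsto (fun n : ℕ => A / (c ^ (1 / (n : ℝ)) * (n : ℝ) ^ (1 / (n : ℝ)))) atTop
        (nhds A) := by
      have := (tendsto_const_nhds (x := A)).div ((hconst c hc).mul hn) (by simp)
      rwa [mul_one, div_one] at this
    have h2 : Tendsto (fun n : ℕ => C ^ (1 / (n : ℝ)) * A) atTop (nhds A) := by
      simpa using (hconst C hC).mul_const A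
    refine tendsto_of_tendsto_of_tendsto_of_le_of_le' h1 h2 ?_ ?_
    · filter_upwards [hlow, eventually_gt_atTop 0] with n h hn
      have hn' : (0 : ℝ) < n := by exact_mod_cast hn
      rw [div_le_iff₀ (by positivity), ← Real.mul_rpow hc.le hn'.le,
        ← Real.mul_rpow (by positivity) (by positivity), ← hroot n hn, mul_comm (u n : ℝ)]
      exact Real.rpow_le_rpow (by positivity) h (by positivity)
    · filter_upwards [hup, eventually_gt_atTop 0] with n h hn
      conv_rhs => rw [← hroot n hn]
      rw [← Real.mul_rpow hC.le (by positivity)]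
      exact Real.rpow_le_rpow (by positivity) h (by positivity)
  exact ((continuous_coe_real_ereal.tendsto A).comp hlim).limsup_eq

theorem pow_le_factorial_mul_multichoose (m n : ℕ) :
    n ^ m ≤ m.factorial * (m + 1).multichoose n := by
  have h : (m + 1).multichoose n = (n + m).choose m := by
    rw [Nat.multichoose_eq, ← Nat.choose_symm_add]
    congr 1
    omega
  rw [h, ← Nat.ascFactorial_eq_factorial_mul_choose]
  exact (Nat.pow_le_pow_left n.le_succ m).trans (Nat.pow_succ_le_ascFactorial _ _)

theorem multichoose_self_le (n : ℕ) : n.multichoose n ≤ 4 ^ n := by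
  rw [Nat.multichoose_eq, show (4 : ℕ) = 2 ^ 2 from rfl, ← pow_mul]
  exact (Nat.choose_le_two_pow _ _).trans (Nat.pow_le_pow_right two_pos (by omega))

theorem four_pow_le_mul_multichoose_self (n : ℕ) (hn : 0 < n) :
    4 ^ n ≤ 4 * n * n.multichoose n := by
  obtain ⟨m, rfl⟩ := Nat.exists_eq_succ_of_ne_zero hn.ne'
  have h1 := Nat.four_pow_le_two_mul_self_mul_centralBinom (m + 1) m.succ_pos
  have h2 : (m + 1).centralBinom = 2 * (m + 1).multichoose (m + 1) := by
    rw [Nat.multichoose_eq, Nat.centralBinom_eq_two_mul_choose,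
      show 2 * (m + 1) = (2 * m + 1) + 1 by ring, Nat.choose_succ_succ,
      show m + 1 + (m + 1) - 1 = 2 * m + 1 by omega, Nat.choose_symm_half]
    ring
  rw [h2] at h1
  exact h1.trans (le_of_eq (by simp only [Nat.succ_eq_add_one]; ring))

/-- The hypotheses hold when `H` is `ℤ` or the infinite dihedral group: the lower bound comes from
`ℤ` and the upper bound from the infinite dihedral group in both cases. -/
theorem isTheta_maxGrowth {G H : Type*} [Group G] [Group H] [Infinite G] [Infinite H]
    (hGH : IsFiniteBy G H) (hlow : ∀ k n, maxGrowth (Multiplicative ℤ) k n ≤ maxGrowth H k n)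
    (hup : ∀ k n, maxGrowth H k n ≤ maxGrowth (DihedralGroup 0) k n) (k : ℕ) (hk : 1 ≤ k) :
    (fun n : ℕ => (maxGrowth G k n : ℝ)) =Θ[atTop] (fun n : ℕ => (n : ℝ) ^ (k - 1)) := by
  obtain ⟨f, hf, hker⟩ := hGH
  obtain ⟨m, rfl⟩ := Nat.exists_eq_succ_of_ne_zero (Nat.one_le_iff_ne_zero.1 hk)
  simp only [Nat.succ_eq_add_one, Nat.add_sub_cancel]
  constructor
  · refine IsBigO.of_bound (Nat.card f.ker * (2 * 3 ^ m)) ?_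
    filter_upwards [eventually_ge_atTop 1] with n hn
    have h1 : maxGrowth G (m + 1) n ≤ Nat.card f.ker * (2 * 3 ^ m) * n ^ m :=
      calc maxGrowth G (m + 1) n ≤ Nat.card f.ker * maxGrowth H (m + 1) n :=
            maxGrowth_le_card_ker_mul f _ _
        _ ≤ Nat.card f.ker * (2 * (2 * n + 1) ^ m) :=
            Nat.mul_le_mul_left _ ((hup _ _).trans (maxGrowth_dihedral_le m n))
        _ ≤ Nat.card f.ker * (2 * (3 * n) ^ m) := by gcongr; omega
        _ = _ := by rw [mul_pow]; ring
    rw [Real.norm_of_nonneg (by positivity), Real.norm_of_nonneg (by positivity)]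
    exact_mod_cast h1
  · refine IsBigO.of_bound m.factorial (Eventually.of_forall fun n => ?_)
    have h1 : n ^ m ≤ m.factorial * maxGrowth G (m + 1) n :=
      (pow_le_factorial_mul_multichoose m n).trans (Nat.mul_le_mul_left _
        ((multichoose_le_maxGrowth_int _ _).trans
          ((hlow _ _).trans (maxGrowth_le_of_surjective f hf _ _))))
    rw [Real.norm_of_nonneg (by positivity), Real.norm_of_nonneg (by positivity)]
    exact_mod_cast h1

theorem limsup_maxGrowth_self_of_isFiniteBy {G H : Type*} [Group G] [Group H] [Infinite G]
    [Infinite H] (hGH : IsFiniteBy G H) {A c : ℝ} (hA : 0 < A) (hc : 0 < c)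
    (hlow : ∀ᶠ n : ℕ in atTop, A ^ n ≤ c * n * maxGrowth H n n)
    (hup : ∀ n : ℕ, (maxGrowth H n n : ℝ) ≤ A ^ n) :
    limsup (fun n : ℕ => (((maxGrowth G n n : ℝ) ^ (1 / (n : ℝ)) : ℝ) : EReal)) atTop
      = (A : EReal) := by
  obtain ⟨f, hf, hker⟩ := hGH
  refine limsup_rpow_one_div_eq (C := Nat.card f.ker) hA hc (by exact_mod_cast Nat.card_pos) ?_ ?_
  · filter_upwards [hlow] with n hn
    refine hn.trans ?_
    gcongr
    exact maxGrowth_le_of_surjective f hf n n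
  · refine Eventually.of_forall fun n => ?_
    calc (maxGrowth G n n : ℝ) ≤ Nat.card f.ker * maxGrowth H n n := by
          exact_mod_cast maxGrowth_le_card_ker_mul f n n
      _ ≤ _ := by gcongr; exact hup n

theorem pow_le_mul_maxGrowth_dihedral (n : ℕ) (hn : 2 ≤ n) :
    (3 + 2 * Real.sqrt 2) ^ n ≤
      (3 + 2 * Real.sqrt 2) ^ 2 * n * maxGrowth (DihedralGroup 0) n n := by
  obtain ⟨d, rfl⟩ := Nat.exists_eq_add_of_le' hn
  have h1 : (l1Ball d d).ncard ≤ maxGrowth (DihedralGroup 0) (d + 2) (d + 2) :=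
    (Set.ncard_le_ncard (l1Ball_subset_l1Ball_succ d d) (finite_l1Ball d (d + 1))).trans
      (ncard_l1Ball_le_maxGrowth_dihedral d (d + 1))
  have h2 : ((l1Ball d d).ncard : ℝ) ≤ maxGrowth (DihedralGroup 0) (d + 2) (d + 2) := by
    exact_mod_cast h1
  have h3 : (d : ℝ) + 1 ≤ (d + 2 : ℕ) := by
    push_cast
    linarith
  generalize maxGrowth (DihedralGroup 0) (d + 2) (d + 2) = g at h2
  rw [pow_add, mul_comm, mul_assoc]
  refine mul_le_mul_of_nonneg_left ((le_mul_ncard_l1Ball_self d).trans ?_) (by positivity)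
  exact mul_le_mul h3 h2 (by positivity) (by positivity)

/-- Here `Multiplicative ℤ` is the infinite cyclic group and `DihedralGroup 0` is the infinite
dihedral group. The upper limits are taken in the extended reals. -/
theorem mainTheorem6 (G : Type*) [Group G] [Infinite G] (hG : IsVirtuallyCyclic G) :
    (∀ k : ℕ, 1 ≤ k →
      (fun n : ℕ => (maxGrowth G k n : ℝ)) =Θ[atTop] (fun n : ℕ => (n : ℝ) ^ (k - 1))) ∧
    (IsFiniteBy G (Multiplicative ℤ) ∨ IsFiniteBy G (DihedralGroup 0)) ∧
    (IsFiniteBy G (Multiplicative ℤ) →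
      limsup (fun n : ℕ => (((maxGrowth G n n : ℝ) ^ (1 / (n : ℝ)) : ℝ) : EReal)) atTop
        = ((4 : ℝ) : EReal)) ∧
    (IsFiniteBy G (DihedralGroup 0) →
      limsup (fun n : ℕ => (((maxGrowth G n n : ℝ) ^ (1 / (n : ℝ)) : ℝ) : EReal)) atTop
        = ((3 + 2 * Real.sqrt 2 : ℝ) : EReal)) := by
  have hcases := isFiniteBy_int_or_dihedral hG
  refine ⟨fun k hk => ?_, hcases, fun h => ?_, fun h => ?_⟩
  · obtain h | h := hcases
    · exact isTheta_maxGrowth h (fun _ _ => le_rfl) maxGrowth_int_le_maxGrowth_dihedral k hk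
    · exact isTheta_maxGrowth h maxGrowth_int_le_maxGrowth_dihedral (fun _ _ => le_rfl) k hk
  · refine limsup_maxGrowth_self_of_isFiniteBy h (c := 4) (by norm_num) (by norm_num) ?_ ?_
    · filter_upwards [eventually_gt_atTop 0] with n hn
      exact_mod_cast (four_pow_le_mul_multichoose_self n hn).trans
        (Nat.mul_le_mul_left _ (multichoose_le_maxGrowth_int n n))
    · intro n
      exact_mod_cast (maxGrowth_int_le_multichoose n n).trans (multichoose_self_le n)
  · refine limsup_maxGrowth_self_of_isFiniteBy h (c := (3 + 2 * Real.sqrt 2) ^ 2)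
      (by positivity) (by positivity) ?_ ?_
    · filter_upwards [eventually_ge_atTop 2] with n hn
      exact pow_le_mul_maxGrowth_dihedral n hn
    · intro n
      exact le_trans (by exact_mod_cast maxGrowth_dihedral_le_ncard_l1Ball n n)
        (ncard_l1Ball_self_le n)
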